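/- **Corollary 6.2 (an $A_r$ nonterminating ${}_3\phi_2$ summation).** Let $q\in\mathbb C$ with $0<|q|<1$, and write $(u;q)_\infty=\prod_{j\ge 0}(1-uq^j)$, $(u;q)_k=\prod_{j=0}^{k-1}(1-uq^j)$ for integers $k\ge 0$, and $(u_1,\dots,u_m;q)_k=(u_1;q)_k\cdots(u_m;q)_k$ for $k\in\{0,1,2,\dots\}\cup\{\infty\}$. Let $r\ge 0$ be an integer, let $a,b,c,e,x_1,\dots,x_r$ be nonzero complex numbers with $x_1,\dots,x_r$ pairwise distinct, and let $f\in\mathbb C$ satisfy $ef=abcq^r$. Assume that no denominator below vanishes, that is, for all integers $n\ge 0$ and all $i$, none of $aq^{1+n}/e$, $bq^{1+n}/e$, $fq^{1+n}/e$, $cq^{1+n}/(ex_i)$, $fx_iq^n$ equals $1$, and $ex_i$ is not an integer power of $q$. Then all the multiple series below converge absolutely, and $$ \begin{aligned} &\sum_{S\subseteq\{1,\dots,r\}}\left(\frac qe\right)^{\binom r2-\binom{|S|}2}\prod_{i\notin S}\frac{(ax_i,\,bx_i,\,c,\,q/(ex_i),\,fq/e;q)_\infty}{(aq/e,\,bq/e,\,cq/(ex_i),\,ex_i/q,\,fx_i;q)_\infty}\\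 &\quad\times\sum_{k_1,\dots,k_r=0}^\infty\ \prod_{\substack{1\le i<j\le r\\ i,j\in S}}\frac{x_iq^{k_i}-x_jq^{k_j}}{x_i-x_j}\prod_{\substack{1\le i<j\le r\\ i,j\notin S}}\frac{q^{k_i}-q^{k_j}}{x_i-x_j}\prod_{i\in S,\,j\notin S}\frac{ex_iq^{k_i-1}-q^{k_j}}{x_i-x_j}\\ &\qquad\times\prod_{i\in S}\frac{(ax_i,\,bx_i,\,c;q)_{k_i}}{(q,\,ex_i,\,fx_i;q)_{k_i}}\prod_{i\notin S}\frac{(aq/e,\,bq/e,\,cq/(ex_i);q)_{k_i}}{(q,\,q^2/(ex_i),\,fq/e;q)_{k_i}}\;q^{k_1+\cdots+k_r}\\ &=\prod_{i=1}^r\frac{(q/(ex_i),\,fq^{1-i}/a,\,fq^{1-i}/b,\,fx_i/c;q)_\infty}{(aq^i/e,\,bq^i/e,\,cq/(ex_i),\,fx_i;q)_\infty}. \end{aligned} $$ -/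

import Mathlib

open scoped BigOperators

/-- The infinite `q`-shifted factorial `(a;q)_∞ = ∏_{j ≥ 0} (1 - a q^j)`. For `‖q‖ < 1` the product
converges for every `a`, see `multipliable_qPochInf`. -/
noncomputable def qPochInf (a q : ℂ) : ℂ := ∏' j : ℕ, (1 - a * q ^ j)

/-- The finite `q`-shifted factorial `(a;q)_k = ∏_{0 ≤ j < k} (1 - a q^j)` for `k ∈ ℕ`. It agrees
with `(a;q)_∞ / (a q^k;q)_∞` whenever that quotient is defined, see `qPoch_mul_qPochInf`. -/
noncomputable def qPoch (a q : ℂ) (k : ℕ) : ℂ := ∏ j ∈ Finset.range k, (1 - a * q ^ j)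

theorem multipliable_qPochInf {q : ℂ} (hq : ‖q‖ < 1) (a : ℂ) :
    Multipliable (fun j : ℕ => 1 - a * q ^ j) := by
  have h : Summable (fun j : ℕ => ‖-(a * q ^ j)‖) := by
    simp only [norm_neg, norm_mul, norm_pow]
    exact (summable_geometric_of_lt_one (norm_nonneg q) hq).mul_left _
  simpa [sub_eq_add_neg] using multipliable_one_add_of_summable h

theorem qPoch_mul_qPochInf {q : ℂ} (hq : ‖q‖ < 1) (a : ℂ) (k : ℕ) :
    qPoch a q k * qPochInf (a * q ^ k) q = qPochInf a q := by
  have e1 : (fun j : ℕ => 1 - a * q ^ k * q ^ j) = fun j : ℕ => 1 - a * q ^ (j + k) := by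
    funext j
    rw [mul_assoc, ← pow_add, add_comm k j]
  have h := multipliable_qPochInf hq (a * q ^ k)
  rw [e1] at h
  have h2 := Multipliable.prod_mul_tprod_nat_mul' (f := fun j : ℕ => 1 - a * q ^ j) (k := k) h
  unfold qPoch qPochInf
  rw [e1]
  exact h2

/-- The factor in front of the inner series belonging to `S ⊆ {1,…,r}`:
`(q/e)^{C(r,2) - C(|S|,2)}
  ∏_{i ∉ S} (a x_i, b x_i, c, q/(e x_i), f q/e; q)_∞
    / (a q/e, b q/e, c q/(e x_i), e x_i/q, f x_i; q)_∞`. -/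
noncomputable def arPrefactor {r : ℕ} (q a b c e f : ℂ) (x : Fin r → ℂ) (S : Finset (Fin r)) : ℂ :=
  (q / e) ^ (r.choose 2 - S.card.choose 2) *
    ∏ i ∈ Sᶜ,
      (qPochInf (a * x i) q * qPochInf (b * x i) q * qPochInf c q *
          qPochInf (q / (e * x i)) q * qPochInf (f * q / e) q) /
        (qPochInf (a * q / e) q * qPochInf (b * q / e) q * qPochInf (c * q / (e * x i)) q *
          qPochInf (e * x i / q) q * qPochInf (f * x i) q)

/-- The summand at `k = (k_1,…,k_r)` of the inner series belonging to `S ⊆ {1,…,r}`. -/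
noncomputable def arSummand {r : ℕ} (q a b c e f : ℂ) (x : Fin r → ℂ) (S : Finset (Fin r))
    (k : Fin r → ℕ) : ℂ :=
  (∏ i ∈ S, ∏ j ∈ S with i < j, (x i * q ^ k i - x j * q ^ k j) / (x i - x j)) *
  (∏ i ∈ Sᶜ, ∏ j ∈ Sᶜ with i < j, (q ^ k i - q ^ k j) / (x i - x j)) *
  (∏ i ∈ S, ∏ j ∈ Sᶜ, (e * x i * q ^ ((k i : ℤ) - 1) - q ^ k j) / (x i - x j)) *
  (∏ i ∈ S,
    (qPoch (a * x i) q (k i) * qPoch (b * x i) q (k i) * qPoch c q (k i)) /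
      (qPoch q q (k i) * qPoch (e * x i) q (k i) * qPoch (f * x i) q (k i))) *
  (∏ i ∈ Sᶜ,
    (qPoch (a * q / e) q (k i) * qPoch (b * q / e) q (k i) * qPoch (c * q / (e * x i)) q (k i)) /
      (qPoch q q (k i) * qPoch (q ^ 2 / (e * x i)) q (k i) * qPoch (f * q / e) q (k i))) *
  q ^ (∑ i, k i)

/-- The product side. The index `i : Fin r` starts at `0` and stands for the `(i+1)`-st of the
indices `1,…,r`, so that `q^{1-i}` and `q^i` become `q^{-i}` and `q^{i+1}`. -/
noncomputable def arProduct {r : ℕ} (q a b c e f : ℂ) (x : Fin r → ℂ) : ℂ :=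
  ∏ i : Fin r,
    (qPochInf (q / (e * x i)) q * qPochInf (f * q ^ (-((i : ℕ) : ℤ)) / a) q *
        qPochInf (f * q ^ (-((i : ℕ) : ℤ)) / b) q * qPochInf (f * x i / c) q) /
      (qPochInf (a * q ^ ((i : ℕ) + 1) / e) q * qPochInf (b * q ^ ((i : ℕ) + 1) / e) q *
        qPochInf (c * q / (e * x i)) q * qPochInf (f * x i) q)

/-! Multiplied by the Vandermonde determinant of the `x i`, each inner series becomes a determinant.
The pair factors and the power of `q / e` combine into the Vandermonde determinant of the nodes `y
i`, where `y i = x i * q ^ k i` for `i ∈ S` and `y i = q / e * q ^ k i` otherwise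
(`arSummand_mul_det_vandermonde`). Expanding that determinant makes the multiple sum the determinant
of the one-variable moments of `₃φ₂` series (`hasSum_prod_mul_det_vandermonde`). By multilinearity
in the rows, the sum over `S` collapses to one determinant with entries `L_i(z ^ j)`, where `L_i` is
the two-term functional `pairMoment` at `x i` (`sum_det_piecewise`).

This determinant is computed in the basis `p_s(z) = (a z; q)_s (b z; q)_{r-1-s}`. Inserting `p_s`
only shifts the upper parameters, and because `e f = a b c q ^ r` the shifted series are balanced.
The nonterminating `q`-Pfaff–Saalschütz sum `balancedPair_eq` then gives `L_i(p_s) = ρ_i * κ_s *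
p_s(x_i)` (`pairMoment_qPoch`). Hence the moment determinant is `∏ ρ_i * ∏ κ_s` times the
Vandermonde determinant of `x`, once the base change is known to be invertible. That requires `a ∉ b
q^ℤ`, a restriction removed by continuity (`det_pairMoment`).

The summation `balancedPair_eq` comes from a contiguous relation `C ↦ C q`. Iterating it sends `C`
to `0`, symmetry does the same for the other parameters, and the remaining constant is found from a
case where both series are geometric. -/

open Filter Topology

/-! ### Elementary identities, bounds and continuity of `q`-shifted factorials -/

section QShiftedFactorials

variable {q : ℂ}

theorem qPoch_zero (u q : ℂ) : qPoch u q 0 = 1 := by simp [qPoch]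

theorem qPoch_succ (u q : ℂ) (k : ℕ) : qPoch u q (k + 1) = qPoch u q k * (1 - u * q ^ k) := by
  simp [qPoch, Finset.prod_range_succ]

theorem qPoch_succ' (u q : ℂ) (k : ℕ) : qPoch u q (k + 1) = (1 - u) * qPoch (u * q) q k := by
  simp only [qPoch, Finset.prod_range_succ', pow_zero, mul_one, mul_comm (1 - u)]
  congr 1
  exact Finset.prod_congr rfl fun i _ => by ring

theorem qPoch_add (u q : ℂ) (m k : ℕ) :
    qPoch u q (m + k) = qPoch u q m * qPoch (u * q ^ m) q k := by
  simp only [qPoch, Finset.prod_range_add]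
  congr 1
  exact Finset.prod_congr rfl fun i _ => by ring

theorem qPoch_mul_qPoch_comm (u q : ℂ) (m k : ℕ) :
    qPoch u q k * qPoch (u * q ^ k) q m = qPoch u q m * qPoch (u * q ^ m) q k := by
  rw [← qPoch_add, ← qPoch_add, add_comm]

theorem qPoch_zero_left (q : ℂ) (k : ℕ) : qPoch 0 q k = 1 := by simp [qPoch]

theorem qPochInf_zero_left (q : ℂ) : qPochInf 0 q = 1 := by simp [qPochInf]

theorem qPoch_ne_zero {u : ℂ} (h : ∀ n : ℕ, u * q ^ n ≠ 1) (k : ℕ) : qPoch u q k ≠ 0 :=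
  Finset.prod_ne_zero_iff.2 fun j _ => sub_ne_zero.2 (h j).symm

theorem mul_pow_ne_one_of_norm_lt (hq : ‖q‖ < 1) (n : ℕ) : q * q ^ n ≠ 1 := fun h => by
  have h1 : ‖q ^ (n + 1)‖ = 1 := by rw [pow_succ', h, norm_one]
  rw [norm_pow] at h1
  exact absurd h1 (pow_lt_one₀ (norm_nonneg _) hq (Nat.succ_ne_zero n)).ne

theorem qPochInf_eq_one_sub_mul (hq : ‖q‖ < 1) (u : ℂ) :
    qPochInf u q = (1 - u) * qPochInf (u * q) q := by
  simpa [qPoch] using (qPoch_mul_qPochInf hq u 1).symm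

theorem summable_norm_mul_pow (hq : ‖q‖ < 1) (u : ℂ) : Summable fun j : ℕ => ‖-(u * q ^ j)‖ := by
  simp only [norm_neg, norm_mul, norm_pow]
  exact (summable_geometric_of_lt_one (norm_nonneg q) hq).mul_left _

theorem qPochInf_ne_zero (hq : ‖q‖ < 1) {u : ℂ} (h : ∀ n : ℕ, u * q ^ n ≠ 1) :
    qPochInf u q ≠ 0 := by
  have := tprod_one_add_ne_zero_of_summable (f := fun j : ℕ => -(u * q ^ j))
    (fun j => by simpa [← sub_eq_add_neg] using sub_ne_zero.2 (h j).symm)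
    (summable_norm_mul_pow hq u)
  simpa only [← sub_eq_add_neg, qPochInf] using this

theorem mul_pow_ne_one_of_qPochInf_ne_zero (hq : ‖q‖ < 1) {u : ℂ} (h : qPochInf u q ≠ 0) (n : ℕ) :
    u * q ^ n ≠ 1 := fun hn => h <| by
  rw [← qPoch_mul_qPochInf hq u (n + 1), qPoch_succ, hn]
  simp

theorem tendsto_qPoch_qPochInf (hq : ‖q‖ < 1) (u : ℂ) :
    Tendsto (qPoch u q) atTop (𝓝 (qPochInf u q)) :=
  (multipliable_qPochInf hq u).hasProd.tendsto_prod_nat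

/-- The bound does not depend on `k`. This is what later allows domination by a geometric series. -/
theorem norm_qPoch_le (hq : ‖q‖ < 1) (u : ℂ) (k : ℕ) :
    ‖qPoch u q k‖ ≤ Real.exp (‖u‖ * (1 - ‖q‖)⁻¹) := by
  rw [qPoch, norm_prod]
  calc ∏ j ∈ Finset.range k, ‖1 - u * q ^ j‖
      ≤ ∏ j ∈ Finset.range k, Real.exp (‖u‖ * ‖q‖ ^ j) :=
        Finset.prod_le_prod (fun _ _ => norm_nonneg _) fun j _ => by
          calc ‖1 - u * q ^ j‖ ≤ ‖(1 : ℂ)‖ + ‖u * q ^ j‖ := norm_sub_le _ _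
            _ = ‖u‖ * ‖q‖ ^ j + 1 := by rw [norm_one, norm_mul, norm_pow, add_comm]
            _ ≤ _ := Real.add_one_le_exp _
    _ = Real.exp (‖u‖ * ∑ j ∈ Finset.range k, ‖q‖ ^ j) := by
        rw [← Real.exp_sum, Finset.mul_sum]
    _ ≤ _ := by
        refine Real.exp_le_exp.2 (mul_le_mul_of_nonneg_left ?_ (norm_nonneg _))
        rw [← tsum_geometric_of_lt_one (norm_nonneg q) hq]
        exact (summable_geometric_of_lt_one (norm_nonneg q) hq).sum_le_tsum _
          fun _ _ => by positivity

theorem norm_qPochInf_le (hq : ‖q‖ < 1) (u : ℂ) :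
    ‖qPochInf u q‖ ≤ Real.exp (‖u‖ * (1 - ‖q‖)⁻¹) :=
  le_of_tendsto (tendsto_qPoch_qPochInf hq u).norm (Eventually.of_forall (norm_qPoch_le hq u))

theorem continuous_qPoch (q : ℂ) (k : ℕ) : Continuous fun u => qPoch u q k := by
  unfold qPoch
  fun_prop

theorem continuous_qPochInf (hq : ‖q‖ < 1) : Continuous fun u => qPochInf u q := by
  rw [continuous_iff_continuousAt]
  intro u₀
  have := tendsto_tprod_one_add_of_dominated_convergence (𝓕 := 𝓝 u₀)
    (f := fun u (j : ℕ) => -(u * q ^ j)) (g := fun j => -(u₀ * q ^ j))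
    (bound := fun j => (‖u₀‖ + 1) * ‖q‖ ^ j)
    ((summable_geometric_of_lt_one (norm_nonneg q) hq).mul_left _)
    (fun k => Continuous.tendsto (by fun_prop) _)
    (by
      filter_upwards [(continuous_norm.tendsto u₀).eventually_lt_const (lt_add_one ‖u₀‖)] with u hu k
      rw [norm_neg, norm_mul, norm_pow]
      gcongr)
  simpa only [← sub_eq_add_neg, ContinuousAt, qPochInf] using this

end QShiftedFactorials

/-! ### Uniform bounds and dominated convergence for series with weight `q ^ k` -/

section UniformBounds

variable {q : ℂ} {α : Type*} {l : Filter α}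

/-- The family of sequences `F t` is bounded uniformly in `t` along the filter `l`. -/
def UniformlyBoundedAlong (l : Filter α) (F : α → ℕ → ℂ) : Prop :=
  ∃ M : ℝ, ∀ᶠ t in l, ∀ k, ‖F t k‖ ≤ M

theorem UniformlyBoundedAlong.mul {F G : α → ℕ → ℂ} (hF : UniformlyBoundedAlong l F)
    (hG : UniformlyBoundedAlong l G) : UniformlyBoundedAlong l fun t k => F t k * G t k := by
  obtain ⟨M, hM⟩ := hF
  obtain ⟨N, hN⟩ := hG
  refine ⟨M * N, ?_⟩
  filter_upwards [hM, hN] with t h1 h2 k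
  rw [norm_mul]
  exact mul_le_mul (h1 k) (h2 k) (norm_nonneg _) ((norm_nonneg _).trans (h1 k))

theorem uniformlyBoundedAlong_qPochInf (hq : ‖q‖ < 1) {u : α → ℂ} {u₀ : ℂ}
    (hu : Tendsto u l (𝓝 u₀)) :
    UniformlyBoundedAlong l fun t k => qPochInf (u t * q ^ k) q := by
  refine ⟨Real.exp ((‖u₀‖ + 1) * (1 - ‖q‖)⁻¹), ?_⟩
  filter_upwards [hu.norm.eventually_lt_const (lt_add_one ‖u₀‖)] with t ht k
  refine (norm_qPochInf_le hq _).trans (Real.exp_le_exp.2 ?_)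
  have : 0 < 1 - ‖q‖ := sub_pos.2 hq
  have h1 : ‖u t * q ^ k‖ ≤ ‖u t‖ := by
    rw [norm_mul, norm_pow]
    exact mul_le_of_le_one_right (norm_nonneg _) (pow_le_one₀ (norm_nonneg _) hq.le)
  gcongr
  exact h1.trans ht.le

theorem uniformlyBoundedAlong_qPoch (hq : ‖q‖ < 1) {u : α → ℂ} {u₀ : ℂ}
    (hu : Tendsto u l (𝓝 u₀)) : UniformlyBoundedAlong l fun t k => qPoch (u t) q k := by
  refine ⟨Real.exp ((‖u₀‖ + 1) * (1 - ‖q‖)⁻¹), ?_⟩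
  filter_upwards [hu.norm.eventually_lt_const (lt_add_one ‖u₀‖)] with t ht k
  refine (norm_qPoch_le hq _ k).trans (Real.exp_le_exp.2 ?_)
  have : 0 < 1 - ‖q‖ := sub_pos.2 hq
  gcongr

/-- The reciprocal equals `(u q^k; q)_∞ / (u; q)_∞`, whose numerator is bounded in `k` and whose
denominator is a nonzero constant. -/
theorem uniformlyBoundedAlong_inv_qPoch (hq : ‖q‖ < 1) {u : ℂ} (hu : ∀ n : ℕ, u * q ^ n ≠ 1) :
    UniformlyBoundedAlong l fun _ k => (qPoch u q k)⁻¹ := by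
  obtain ⟨M, hM⟩ := uniformlyBoundedAlong_qPochInf (l := pure ()) hq
    (tendsto_const_nhds (x := u))
  refine ⟨M * ‖qPochInf u q‖⁻¹, Eventually.of_forall fun _ k => ?_⟩
  have h1 : (qPoch u q k)⁻¹ = qPochInf (u * q ^ k) q * (qPochInf u q)⁻¹ := by
    have h := qPochInf_ne_zero hq hu
    rw [← qPoch_mul_qPochInf hq u k] at h ⊢
    rw [mul_inv, mul_left_comm, mul_inv_cancel₀ (right_ne_zero_of_mul h), mul_one]
  change ‖(qPoch u q k)⁻¹‖ ≤ _
  rw [h1, norm_mul, norm_inv]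
  exact mul_le_mul_of_nonneg_right (eventually_pure.1 hM k) (by positivity)

theorem UniformlyBoundedAlong.tendsto_tsum (hq : ‖q‖ < 1) {F : α → ℕ → ℂ} {G : ℕ → ℂ}
    (hF : UniformlyBoundedAlong l F) (hG : ∀ k, Tendsto (fun t => F t k) l (𝓝 (G k))) :
    Tendsto (fun t => ∑' k, q ^ k * F t k) l (𝓝 (∑' k, q ^ k * G k)) := by
  obtain ⟨M, hM⟩ := hF
  refine tendsto_tsum_of_dominated_convergence (bound := fun k => ‖q‖ ^ k * M)
    ((summable_geometric_of_lt_one (norm_nonneg q) hq).mul_right _)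
    (fun k => (hG k).const_mul _) ?_
  filter_upwards [hM] with t ht k
  rw [norm_mul, norm_pow]
  exact mul_le_mul_of_nonneg_left (ht k) (by positivity)

theorem UniformlyBoundedAlong.summable (hq : ‖q‖ < 1) {F : ℕ → ℂ}
    (hF : UniformlyBoundedAlong (pure ()) fun _ => F) : Summable fun k => q ^ k * F k := by
  obtain ⟨M, hM⟩ := hF
  refine Summable.of_norm_bounded (g := fun k => ‖q‖ ^ k * M)
    ((summable_geometric_of_lt_one (norm_nonneg q) hq).mul_right _) fun k => ?_
  rw [norm_mul, norm_pow]
  exact mul_le_mul_of_nonneg_left (eventually_pure.1 hM k) (by positivity)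

end UniformBounds

/-! ### The nonterminating `q`-Pfaff–Saalschütz summation -/

section NonterminatingSaalschutz

variable {q w : ℂ}

/-- The general coefficient of the balanced `₃φ₂` series with lower parameters `q / w` and
`A B C w`, multiplied by `(A B C w; q)_∞`. -/
noncomputable def balancedTerm (q w A B C : ℂ) (k : ℕ) : ℂ :=
  qPoch A q k * qPoch B q k * qPoch C q k * (qPoch q q k)⁻¹ * (qPoch (q * w⁻¹) q k)⁻¹ *
    qPochInf (A * B * C * w * q ^ k) q

/-- The balanced `₃φ₂` series with lower parameters `q / w` and `A B C w`,
multiplied by `(A B C w; q)_∞`. -/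
noncomputable def balancedSeries (q w A B C : ℂ) : ℂ := ∑' k, q ^ k * balancedTerm q w A B C k

/-- The two-term combination of balanced series in the nonterminating
`q`-Pfaff–Saalschütz summation, cleared of denominators depending on `A`, `B`, `C`. -/
noncomputable def balancedPair (q w A B C : ℂ) : ℂ :=
  qPochInf (A * w) q * qPochInf (B * w) q * qPochInf (C * w) q * balancedSeries q w A B C /
      qPochInf w q +
    qPochInf A q * qPochInf B q * qPochInf C q * balancedSeries q w⁻¹ (A * w) (B * w) (C * w) /
      qPochInf w⁻¹ q

theorem uniformlyBoundedAlong_balancedTerm (hq : ‖q‖ < 1) (hw : ∀ n : ℕ, q * w⁻¹ * q ^ n ≠ 1)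
    {α : Type*} {l : Filter α} (A B : ℂ) {C : α → ℂ} {C₀ : ℂ} (hC : Tendsto C l (𝓝 C₀)) :
    UniformlyBoundedAlong l fun t k => balancedTerm q w A B (C t) k :=
  (((((uniformlyBoundedAlong_qPoch hq tendsto_const_nhds).mul
    (uniformlyBoundedAlong_qPoch hq tendsto_const_nhds)).mul
    (uniformlyBoundedAlong_qPoch hq hC)).mul
    (uniformlyBoundedAlong_inv_qPoch hq (mul_pow_ne_one_of_norm_lt hq))).mul
    (uniformlyBoundedAlong_inv_qPoch hq hw)).mul
    (uniformlyBoundedAlong_qPochInf hq ((hC.const_mul (A * B)).mul_const w))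

theorem summable_balancedTerm (hq : ‖q‖ < 1) (hw : ∀ n : ℕ, q * w⁻¹ * q ^ n ≠ 1) (A B C : ℂ) :
    Summable fun k => q ^ k * balancedTerm q w A B C k :=
  (uniformlyBoundedAlong_balancedTerm hq hw A B (tendsto_const_nhds (x := C))).summable hq

theorem continuous_balancedSeries (hq : ‖q‖ < 1) (hw : ∀ n : ℕ, q * w⁻¹ * q ^ n ≠ 1) (A B : ℂ) :
    Continuous fun C => balancedSeries q w A B C := by
  rw [continuous_iff_continuousAt]
  intro C₀
  refine (uniformlyBoundedAlong_balancedTerm hq hw A B tendsto_id).tendsto_tsum hq fun k => ?_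
  have h1 := continuous_qPoch q k
  have h2 := continuous_qPochInf hq
  have : Continuous fun C => balancedTerm q w A B C k := by
    unfold balancedTerm
    fun_prop
  exact this.tendsto C₀

/-- The contiguous combination of the series at `C` and `C q` telescopes; the right side is the
surviving boundary term. -/
theorem sum_range_balancedTerm_sub (hq : ‖q‖ < 1) (hw0 : w ≠ 0)
    (hw : ∀ n : ℕ, q * w⁻¹ * q ^ n ≠ 1) (A B C : ℂ) (n : ℕ) :
    ∑ k ∈ Finset.range (n + 1), ((1 - C * w) * (q ^ k * balancedTerm q w A B C k) -
        (1 - B * C * w) * (1 - A * C * w) * (q ^ k * balancedTerm q w A B (C * q) k)) =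
      -(C * w) * qPoch A q (n + 1) * qPoch B q (n + 1) * qPoch (C * q) q n *
        qPochInf (A * B * C * w * q ^ (n + 1)) q * (qPoch q q n)⁻¹ * (qPoch (q * w⁻¹) q n)⁻¹ := by
  have e1 (k : ℕ) : qPochInf (A * B * C * w * q ^ k) q =
      (1 - A * B * C * w * q ^ k) * qPochInf (A * B * C * w * q ^ (k + 1)) q := by
    rw [qPochInf_eq_one_sub_mul hq, pow_succ]
    ring_nf
  have e2 (k : ℕ) : A * B * (C * q) * w * q ^ k = A * B * C * w * q ^ (k + 1) := by ring
  induction n with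
  | zero =>
    simp only [zero_add, Finset.sum_range_one, balancedTerm, qPoch_succ, qPoch_zero, e2]
    rw [e1 0]
    ring
  | succ n ih =>
    rw [Finset.sum_range_succ, ih]
    simp only [balancedTerm, e2]
    rw [e1 (n + 1), qPoch_succ' C, qPoch_succ (C * q), qPoch_succ A q (n + 1),
      qPoch_succ B q (n + 1), qPoch_succ q, qPoch_succ (q * w⁻¹)]
    have h1 := qPoch_ne_zero (mul_pow_ne_one_of_norm_lt hq) n
    have h2 := qPoch_ne_zero hw n
    have h3 : 1 - q * q ^ n ≠ 0 := sub_ne_zero.2 (mul_pow_ne_one_of_norm_lt hq n).symm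
    have h4 : 1 - q * w⁻¹ * q ^ n ≠ 0 := sub_ne_zero.2 (hw n).symm
    have h5 : w - q * q ^ n ≠ 0 := fun h => h4 (by
      rw [show 1 - q * w⁻¹ * q ^ n = (w - q * q ^ n) / w by field_simp, h, zero_div])
    generalize qPoch A q (n + 1) = x1
    generalize qPoch B q (n + 1) = x2
    generalize qPoch (C * q) q n = x3
    generalize qPochInf (A * B * C * w * q ^ (n + 1 + 1)) q = x4
    generalize qPoch q q n = x5 at *
    generalize qPoch (q * w⁻¹) q n = x6 at *
    have e3 : (1 - q * w⁻¹ * q ^ n) = (w - q * q ^ n) / w := by field_simp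
    rw [e3]
    field_simp
    ring

theorem balancedSeries_sub (hq : ‖q‖ < 1) (hw0 : w ≠ 0)
    (hw : ∀ n : ℕ, q * w⁻¹ * q ^ n ≠ 1) (A B C : ℂ) :
    (1 - C * w) * balancedSeries q w A B C -
        (1 - B * C * w) * (1 - A * C * w) * balancedSeries q w A B (C * q) =
      -(C * w) * qPochInf A q * qPochInf B q * qPochInf (C * q) q /
        (qPochInf q q * qPochInf (q * w⁻¹) q) := by
  have hs := (((summable_balancedTerm hq hw A B C).hasSum.mul_left (1 - C * w)).sub
    ((summable_balancedTerm hq hw A B (C * q)).hasSum.mul_left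
      ((1 - B * C * w) * (1 - A * C * w)))).tendsto_sum_nat
  have hs' := hs.comp (tendsto_add_atTop_nat 1)
  refine tendsto_nhds_unique hs' ?_
  simp only [Function.comp_def, sum_range_balancedTerm_sub hq hw0 hw]
  have hA := (tendsto_qPoch_qPochInf hq A).comp (tendsto_add_atTop_nat 1)
  have hB := (tendsto_qPoch_qPochInf hq B).comp (tendsto_add_atTop_nat 1)
  have hC := tendsto_qPoch_qPochInf hq (C * q)
  have hQ := (tendsto_qPoch_qPochInf hq q).inv₀
    (qPochInf_ne_zero hq (mul_pow_ne_one_of_norm_lt hq))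
  have hW := (tendsto_qPoch_qPochInf hq (q * w⁻¹)).inv₀ (qPochInf_ne_zero hq hw)
  have hF : Tendsto (fun n : ℕ => qPochInf (A * B * C * w * q ^ (n + 1)) q) atTop (𝓝 1) := by
    have h0 := ((tendsto_pow_atTop_nhds_zero_of_norm_lt_one hq).comp
      (tendsto_add_atTop_nat 1)).const_mul (A * B * C * w)
    have := ((continuous_qPochInf hq).tendsto _).comp h0
    simpa [Function.comp_def, qPochInf_zero_left] using this
  have := (((((hA.const_mul (-(C * w))).mul hB).mul hC).mul hF).mul hQ).mul hW
  simp only [Function.comp_def] at this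
  convert this using 2
  rw [mul_one, div_eq_mul_inv, mul_inv]
  ring

theorem balancedSeries_swap_left (q w A B C : ℂ) :
    balancedSeries q w A B C = balancedSeries q w B A C := by
  simp only [balancedSeries, balancedTerm, mul_comm A B, mul_comm (qPoch A q _)]

theorem balancedSeries_swap_right (q w A B C : ℂ) :
    balancedSeries q w A B C = balancedSeries q w A C B := by
  simp only [balancedSeries, balancedTerm, mul_right_comm A B C,
    mul_right_comm _ (qPoch B q _) (qPoch C q _)]

theorem balancedPair_swap_left (q w A B C : ℂ) :
    balancedPair q w A B C = balancedPair q w B A C := by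
  simp only [balancedPair, balancedSeries_swap_left _ _ A, balancedSeries_swap_left _ _ (A * w)]
  ring

theorem balancedPair_swap_right (q w A B C : ℂ) :
    balancedPair q w A B C = balancedPair q w A C B := by
  simp only [balancedPair, balancedSeries_swap_right _ _ _ B,
    balancedSeries_swap_right _ _ _ (B * w)]
  ring

theorem mul_pow_ne_one_of_ne_zpow (hw : ∀ m : ℤ, w ≠ q ^ m) (n : ℕ) :
    w * q ^ n ≠ 1 := fun h => hw (-n) (by
  rw [zpow_neg, zpow_natCast]
  exact eq_inv_of_mul_eq_one_left h)

theorem inv_ne_zpow (hw : ∀ m : ℤ, w ≠ q ^ m) (m : ℤ) : w⁻¹ ≠ q ^ m := fun h =>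
  hw (-m) (by rw [zpow_neg, ← h, inv_inv])

theorem mul_ne_zpow (hq0 : q ≠ 0) (hw : ∀ m : ℤ, w ≠ q ^ m) (m : ℤ) : q * w ≠ q ^ m := fun h =>
  hw (m - 1) (by rw [zpow_sub_one₀ hq0, ← h]; field_simp)

/-- Each of the two series satisfies the inhomogeneous relation `balancedSeries_sub`. In the
weighted pair the two inhomogeneous terms cancel, since they agree up to the factors `1 / (1 - w)`
and `1 / (w - 1)`. -/
theorem balancedPair_mul_q (hq0 : q ≠ 0) (hq : ‖q‖ < 1) (hw0 : w ≠ 0) (hw : ∀ m : ℤ, w ≠ q ^ m)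
    (A B C : ℂ) : balancedPair q w A B C =
      (1 - B * C * w) * (1 - A * C * w) * balancedPair q w A B (C * q) := by
  have hwq := mul_pow_ne_one_of_ne_zpow (mul_ne_zpow hq0 hw)
  have hwq' := mul_pow_ne_one_of_ne_zpow (mul_ne_zpow hq0 (inv_ne_zpow hw))
  have h1 := balancedSeries_sub hq hw0 hwq' A B C
  have h2 := balancedSeries_sub hq (inv_ne_zero hw0) (by rwa [inv_inv]) (A * w) (B * w) (C * w)
  rw [inv_inv, show C * w * w⁻¹ = C by field_simp, show B * w * (C * w) * w⁻¹ = B * C * w by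
    field_simp, show A * w * (C * w) * w⁻¹ = A * C * w by field_simp,
    show C * w * q = C * q * w by ring] at h2
  have hn1 : (1 : ℂ) - w ≠ 0 := sub_ne_zero.2 fun h => hw 0 (by simp [h])
  have hn2 : w - 1 ≠ 0 := fun h => hn1 (by linear_combination -h)
  have hqq := qPochInf_ne_zero hq (mul_pow_ne_one_of_norm_lt hq)
  have hq1 := qPochInf_ne_zero hq hwq
  have hq2 := qPochInf_ne_zero hq hwq'
  simp only [balancedPair]
  rw [qPochInf_eq_one_sub_mul hq w, qPochInf_eq_one_sub_mul hq w⁻¹,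
    qPochInf_eq_one_sub_mul hq C, qPochInf_eq_one_sub_mul hq (C * w),
    show C * w * q = C * q * w by ring, mul_comm w q, mul_comm w⁻¹ q]
  have e3 : 1 - w⁻¹ = (w - 1) / w := by field_simp
  rw [e3]
  have h1' := eq_add_of_sub_eq h1
  have h2' := eq_add_of_sub_eq h2
  generalize balancedSeries q w A B C = s1 at *
  generalize balancedSeries q w⁻¹ (A * w) (B * w) (C * w) = s2 at *
  generalize balancedSeries q w A B (C * q) = s3 at *
  generalize balancedSeries q w⁻¹ (A * w) (B * w) (C * q * w) = s4 at *
  generalize qPochInf q q = z at *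
  generalize qPochInf (q * w) q = z1 at *
  generalize qPochInf (q * w⁻¹) q = z2 at *
  generalize qPochInf (C * q) q = y1 at *
  generalize qPochInf (C * q * w) q = y2 at *
  generalize qPochInf A q = y3 at *
  generalize qPochInf B q = y4 at *
  generalize qPochInf (A * w) q = y5 at *
  generalize qPochInf (B * w) q = y6 at *
  calc _ = y5 * y6 * y2 * ((1 - C * w) * s1) / ((1 - w) * z1) +
        y3 * y4 * y1 * ((1 - C) * s2) / ((w - 1) / w * z2) := by ring
    _ = _ := by
      rw [h1', h2', show w - 1 = -(1 - w) by ring]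
      field_simp
      ring

/-- Iterating the contiguous relation replaces `C` by `C q ^ n`, and continuity at `C = 0` permits
`n → ∞`. -/
theorem balancedPair_eq_mul_zero (hq0 : q ≠ 0) (hq : ‖q‖ < 1) (hw0 : w ≠ 0)
    (hw : ∀ m : ℤ, w ≠ q ^ m) (A B C : ℂ) : balancedPair q w A B C =
      qPochInf (B * C * w) q * qPochInf (A * C * w) q * balancedPair q w A B 0 := by
  have hwq := mul_pow_ne_one_of_ne_zpow (mul_ne_zpow hq0 hw)
  have hwq' := mul_pow_ne_one_of_ne_zpow (mul_ne_zpow hq0 (inv_ne_zpow hw))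
  have hn (n : ℕ) : balancedPair q w A B C =
      qPoch (B * C * w) q n * qPoch (A * C * w) q n * balancedPair q w A B (C * q ^ n) := by
    induction n with
    | zero => simp [qPoch_zero]
    | succ n ih =>
      rw [ih, balancedPair_mul_q hq0 hq hw0 hw, qPoch_succ, qPoch_succ, pow_succ,
        ← mul_assoc C]
      ring
  have hcont : Continuous fun C => balancedPair q w A B C := by
    have h1 := continuous_balancedSeries hq hwq' A B
    have h2 := continuous_balancedSeries (w := w⁻¹) hq (by rwa [inv_inv]) (A * w) (B * w)
    have h3 := continuous_qPochInf hq
    unfold balancedPair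
    fun_prop
  have h0 : Tendsto (fun n : ℕ => C * q ^ n) atTop (𝓝 0) := by
    simpa using (tendsto_pow_atTop_nhds_zero_of_norm_lt_one hq).const_mul C
  refine tendsto_nhds_unique (tendsto_const_nhds (f := atTop (α := ℕ))) ?_
  refine Tendsto.congr (fun n => (hn n).symm) ?_
  exact ((tendsto_qPoch_qPochInf hq _).mul (tendsto_qPoch_qPochInf hq _)).mul
    ((hcont.tendsto 0).comp h0)

theorem balancedPair_zero_right (hq0 : q ≠ 0) (hq : ‖q‖ < 1) (hw0 : w ≠ 0)
    (hw : ∀ m : ℤ, w ≠ q ^ m) (A B : ℂ) : balancedPair q w A B 0 =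
      qPochInf (A * B * w) q * balancedPair q w 0 0 0 := by
  rw [balancedPair_swap_right, balancedPair_eq_mul_zero hq0 hq hw0 hw, balancedPair_swap_left,
    balancedPair_swap_right, balancedPair_eq_mul_zero hq0 hq hw0 hw 0 0 A]
  simp [qPochInf_zero_left]

theorem balancedSeries_eq_geometric (hq : ‖q‖ < 1) (hw : ∀ n : ℕ, q * w⁻¹ * q ^ n ≠ 1) :
    balancedSeries q w q (q * w⁻¹) 0 = (1 - q)⁻¹ := by
  rw [← tsum_geometric_of_norm_lt_one hq, balancedSeries]
  congr 1 with k
  have h1 := qPoch_ne_zero (mul_pow_ne_one_of_norm_lt hq) k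
  have h2 := qPoch_ne_zero hw k
  simp only [balancedTerm, qPoch_zero_left, mul_zero, zero_mul, qPochInf_zero_left]
  generalize qPoch (q * w⁻¹) q k = y at *
  field_simp

theorem balancedPair_zero (hq0 : q ≠ 0) (hq : ‖q‖ < 1) (hw0 : w ≠ 0)
    (hw : ∀ m : ℤ, w ≠ q ^ m) : balancedPair q w 0 0 0 = 1 := by
  have hwq := mul_pow_ne_one_of_ne_zpow (mul_ne_zpow hq0 hw)
  have hwq' := mul_pow_ne_one_of_ne_zpow (mul_ne_zpow hq0 (inv_ne_zpow hw))
  -- With `A = q`, `B = q / w`, `C = 0` the upper parameters cancel the denominators `(q; q)_k` and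
  -- `(q / w; q)_k`, and similarly in the companion series, so both are geometric.
  have h := balancedPair_zero_right hq0 hq hw0 hw q (q * w⁻¹)
  have hs := balancedSeries_eq_geometric hq hwq'
  have hs' := balancedSeries_eq_geometric (w := w⁻¹) hq (by rwa [inv_inv])
  rw [inv_inv] at hs'
  have hn1 : (1 : ℂ) - w ≠ 0 := sub_ne_zero.2 fun h => hw 0 (by simp [h])
  have hn2 : w - 1 ≠ 0 := fun h => hn1 (by linear_combination -h)
  have hqq := qPochInf_ne_zero hq (mul_pow_ne_one_of_norm_lt hq)
  have hq1 := qPochInf_ne_zero hq hwq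
  have hq2 := qPochInf_ne_zero hq hwq'
  have hq3 : (1 : ℂ) - q ≠ 0 := by
    simpa using sub_ne_zero.2 (mul_pow_ne_one_of_norm_lt hq 0).symm
  rw [balancedPair, hs, zero_mul, qPochInf_zero_left, show q * w⁻¹ * w = q by field_simp,
    balancedSeries_swap_left, hs', qPochInf_eq_one_sub_mul hq w, qPochInf_eq_one_sub_mul hq w⁻¹,
    mul_comm w q, mul_comm w⁻¹ q, qPochInf_eq_one_sub_mul hq q,
    show q * (q * w⁻¹) * w = q * q by field_simp] at h
  rw [qPochInf_eq_one_sub_mul hq q] at hqq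
  have hz := right_ne_zero_of_mul hqq
  refine mul_left_cancel₀ hz (h.symm.trans ?_)
  have e3 : 1 - w⁻¹ = -(1 - w) / w := by rw [eq_div_iff hw0, sub_mul, inv_mul_cancel₀ hw0]; ring
  rw [e3]
  generalize qPochInf (q * w⁻¹) q = y at *
  generalize qPochInf (q * q) q = z at *
  field_simp
  ring

/-- The nonterminating `q`-Pfaff–Saalschütz summation. -/
theorem balancedPair_eq (hq0 : q ≠ 0) (hq : ‖q‖ < 1) (hw0 : w ≠ 0) (hw : ∀ m : ℤ, w ≠ q ^ m)
    (A B C : ℂ) : balancedPair q w A B C =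
      qPochInf (A * B * w) q * qPochInf (A * C * w) q * qPochInf (B * C * w) q := by
  rw [balancedPair_eq_mul_zero hq0 hq hw0 hw, balancedPair_zero_right hq0 hq hw0 hw,
    balancedPair_zero hq0 hq hw0 hw]
  ring

end NonterminatingSaalschutz

/-! ### Multiple series as determinants of single series -/

section MultipleSeries

theorem HasSum.mul_prod {α β : Type*} {f : α → ℂ} {g : β → ℂ} {s t : ℂ} (hf : HasSum f s)
    (hg : HasSum g t) : HasSum (fun z : α × β => f z.1 * g z.2) (s * t) := by
  have hf' := hf.summable.norm
  have hg' := hg.summable.norm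
  exact hf.mul hg (summable_mul_of_summable_norm hf' hg')

theorem hasSum_prod_pi {r : ℕ} (f : Fin r → ℕ → ℂ) (hf : ∀ i, Summable (f i)) :
    HasSum (fun k : Fin r → ℕ => ∏ i, f i (k i)) (∏ i, ∑' n, f i n) := by
  induction r with
  | zero => simp
  | succ r ih =>
    have h := ih (fun i => f i.succ) fun i => hf i.succ
    obtain ⟨φ, hφ⟩ : ∃ φ : ℕ × (Fin r → ℕ) ≃ (Fin (r + 1) → ℕ),
        ∀ z, φ z = Fin.cons z.1 z.2 :=
      ⟨Fin.consEquiv fun _ => ℕ, fun _ => rfl⟩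
    have e : (fun k : Fin (r + 1) → ℕ => ∏ i, f i (k i)) ∘ φ =
        fun z : ℕ × (Fin r → ℕ) => f 0 z.1 * ∏ i, f i.succ (z.2 i) := by
      funext z
      simp only [Function.comp_apply, hφ, Fin.prod_univ_succ, Fin.cons_zero, Fin.cons_succ]
    rw [← φ.hasSum_iff, e, Fin.prod_univ_succ]
    have h0 := (hf 0).hasSum
    have := h0.mul_prod h
    exact this

/-- In the Leibniz expansion every permutation contributes a product of functions of separate
variables, so its multiple sum factors. -/
theorem hasSum_prod_mul_det_vandermonde {r : ℕ} (W N : Fin r → ℕ → ℂ)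
    (hs : ∀ (i j : Fin r), Summable fun k => W i k * N i k ^ (j : ℕ)) :
    HasSum (fun k : Fin r → ℕ => (∏ i, W i (k i)) * (Matrix.vandermonde fun i => N i (k i)).det)
      (Matrix.of fun i j : Fin r => ∑' k, W i k * N i k ^ (j : ℕ)).det := by
  have h := hasSum_sum (s := Finset.univ) fun (σ : Equiv.Perm (Fin r)) _ =>
    (hasSum_prod_pi (fun i k => W i k * N i k ^ (σ i : ℕ)) fun i => hs i (σ i)).mul_left
      ((Equiv.Perm.sign σ : ℤ) : ℂ)
  rw [← Matrix.det_transpose, Matrix.det_apply']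
  refine h.congr_fun fun k => ?_
  rw [← Matrix.det_transpose, Matrix.det_apply', Finset.mul_sum]
  refine Finset.sum_congr rfl fun σ _ => ?_
  simp only [Matrix.transpose_apply, Matrix.vandermonde_apply, Finset.prod_mul_distrib]
  ring

/-- The determinant is multilinear in the rows: `S` records the rows in which the summand `α` is
chosen. -/
theorem sum_det_piecewise {r : ℕ} (α β : Matrix (Fin r) (Fin r) ℂ) (p : Fin r → ℂ) :
    ∑ S : Finset (Fin r), (∏ i ∈ Sᶜ, p i) * (Matrix.of (S.piecewise α β)).det =
      (Matrix.of fun i j => α i j + p i * β i j).det := by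
  have h := (Matrix.detRowAlternating (R := ℂ) (n := Fin r)).toMultilinearMap.map_add_univ α
    (fun i => p i • β i)
  refine Eq.trans (Finset.sum_congr rfl fun S _ => ?_) h.symm
  have h2 := Matrix.det_mul_column (fun i => if i ∈ S then 1 else p i)
    (Matrix.of (S.piecewise α β))
  rw [Finset.prod_ite, Finset.prod_const_one, one_mul, Finset.filter_not,
    Finset.filter_univ_mem, ← Finset.compl_eq_univ_sdiff] at h2
  rw [← h2]
  change Matrix.det _ = Matrix.det _
  congr 1
  ext i j
  by_cases hi : i ∈ S <;> simp [Finset.piecewise, hi]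

end MultipleSeries

/-! ### Products over pairs split by a subset -/

section PairProducts

variable {M : Type*} [CommMonoid M]

/-- A pair separated by `S` may have its member of `S` as either the smaller or the larger index;
symmetry of `g` allows orienting all such pairs from `S` to its complement. -/
theorem prod_lt_eq_mul_of_symm {r : ℕ} (g : Fin r → Fin r → M) (hg : ∀ i j, g i j = g j i)
    (S : Finset (Fin r)) :
    ∏ i, ∏ j with i < j, g i j =
      (∏ i ∈ S, ∏ j ∈ S with i < j, g i j) * (∏ i ∈ Sᶜ, ∏ j ∈ Sᶜ with i < j, g i j) *
        ∏ i ∈ S, ∏ j ∈ Sᶜ, g i j := by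
  have h1 (i : Fin r) : ∏ j with i < j, g i j =
      (∏ j ∈ S with i < j, g i j) * ∏ j ∈ Sᶜ with i < j, g i j := by
    simp only [Finset.prod_filter]
    exact (Finset.prod_mul_prod_compl S _).symm
  have h2 : ∏ i ∈ Sᶜ, ∏ j ∈ S with i < j, g i j = ∏ i ∈ S, ∏ j ∈ Sᶜ with ¬ i < j, g i j := by
    simp only [Finset.prod_filter]
    rw [Finset.prod_comm]
    refine Finset.prod_congr rfl fun i hi => Finset.prod_congr rfl fun j hj => ?_
    have hne : i ≠ j := fun h => Finset.mem_compl.1 hj (h ▸ hi)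
    rw [hg j i]
    congr 1
    simp only [not_lt, eq_iff_iff]
    exact ⟨le_of_lt, fun h => lt_of_le_of_ne h hne.symm⟩
  have h3 : ∏ i ∈ S, ∏ j ∈ Sᶜ, g i j = (∏ i ∈ S, ∏ j ∈ Sᶜ with i < j, g i j) *
      ∏ i ∈ S, ∏ j ∈ Sᶜ with ¬ i < j, g i j := by
    rw [← Finset.prod_mul_distrib]
    exact Finset.prod_congr rfl fun i _ => (Finset.prod_filter_mul_prod_filter_not _ _ _).symm
  simp only [h1, Finset.prod_mul_distrib]
  rw [← Finset.prod_mul_prod_compl S, ← Finset.prod_mul_prod_compl S, h2, h3]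
  simp only [mul_assoc, mul_left_comm, mul_comm]

theorem prod_lt_const {r : ℕ} (t : M) (S : Finset (Fin r)) :
    ∏ i ∈ S, ∏ j ∈ S with i < j, t = t ^ S.card.choose 2 := by
  induction S using Finset.induction_on_max with
  | empty => simp
  | insert m S hm ih =>
    have hmS : m ∉ S := fun h => lt_irrefl _ (hm m h)
    rw [Finset.prod_insert hmS, Finset.card_insert_of_notMem hmS, Nat.choose_succ_succ' _ 1,
      Nat.choose_one_right, pow_add, ← ih]
    have e1 : {j ∈ insert m S | m < j} = (∅ : Finset (Fin r)) := by
      ext j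
      simp only [Finset.mem_filter, Finset.mem_insert, Finset.notMem_empty, iff_false, not_and]
      rintro (rfl | h)
      · exact lt_irrefl _
      · exact (hm j h).not_gt
    rw [e1, Finset.prod_empty, one_mul, ← Finset.prod_const, ← Finset.prod_mul_distrib]
    refine Finset.prod_congr rfl fun i hi => ?_
    rw [Finset.filter_insert, if_pos (hm i hi), Finset.prod_insert (by simp [hmS])]

/-- The exponent counts the pairs not contained in `S`; the natural subtraction does not truncate
because `S.card ≤ r`. -/
theorem pow_choose_sub_eq {r : ℕ} {t : ℂ} (ht : t ≠ 0) (S : Finset (Fin r)) :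
    t ^ (r.choose 2 - S.card.choose 2) =
      (∏ i ∈ Sᶜ, ∏ j ∈ Sᶜ with i < j, t) * ∏ _i ∈ S, ∏ _j ∈ Sᶜ, t := by
  have h := prod_lt_eq_mul_of_symm (fun _ _ => t) (fun _ _ => rfl) S
  have h0 : ∏ i : Fin r, ∏ j with i < j, t = t ^ r.choose 2 := by
    simpa using prod_lt_const t (Finset.univ : Finset (Fin r))
  have hle : S.card ≤ r := by simpa using S.card_le_univ
  rw [h0, prod_lt_const t S, mul_assoc] at h
  rw [pow_sub₀ _ ht (Nat.choose_le_choose 2 hle), h]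
  field_simp

end PairProducts

/-! ### The summand as a weight times a Vandermonde determinant -/

section SummandAsDeterminant

variable {r : ℕ} {q a b c e f : ℂ} {x : Fin r → ℂ}

/-- The general term, without its power of `q`, of a `₃φ₂` series. -/
noncomputable def phiTerm (q A B C E F : ℂ) (k : ℕ) : ℂ :=
  qPoch A q k * qPoch B q k * qPoch C q k / (qPoch q q k * qPoch E q k * qPoch F q k)

theorem det_vandermonde_eq_prod_lt (y : Fin r → ℂ) :
    (Matrix.vandermonde y).det = ∏ i, ∏ j with i < j, (y j - y i) := by
  rw [Matrix.det_vandermonde]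
  refine Finset.prod_congr rfl fun i _ => Finset.prod_congr ?_ fun _ _ => rfl
  ext j
  simp

theorem det_vandermonde_div (hx : Function.Injective x) (y : Fin r → ℂ) :
    (Matrix.vandermonde y).det =
      (∏ i, ∏ j with i < j, (y i - y j) / (x i - x j)) * (Matrix.vandermonde x).det := by
  simp only [det_vandermonde_eq_prod_lt, ← Finset.prod_mul_distrib]
  refine Finset.prod_congr rfl fun i _ => Finset.prod_congr rfl fun j hj => ?_
  have : x i - x j ≠ 0 := sub_ne_zero.2 fun h => (Finset.mem_filter.1 hj).2.ne (hx h)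
  field_simp
  ring

/-- Every pair not inside `S` absorbs one factor `q / e`, which turns its numerator into a
difference of nodes; for a mixed pair, `(q / e) (e x_i q^{k_i - 1} - q^{k_j}) = x_i q^{k_i} - (q /
e) q^{k_j}`. -/
theorem arSummand_mul_det_vandermonde (hq0 : q ≠ 0) (he : e ≠ 0) (hx : Function.Injective x)
    (S : Finset (Fin r)) (k : Fin r → ℕ) :
    (q / e) ^ (r.choose 2 - S.card.choose 2) * arSummand q a b c e f x S k *
        (Matrix.vandermonde x).det =
      (∏ i, S.piecewise
          (fun i k => q ^ k * phiTerm q (a * x i) (b * x i) c (e * x i) (f * x i) k)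
          (fun i k => q ^ k * phiTerm q (a * q / e) (b * q / e) (c * q / (e * x i))
            (q ^ 2 / (e * x i)) (f * q / e) k) i (k i)) *
        (Matrix.vandermonde fun i => S.piecewise (fun i k => x i * q ^ k)
          (fun _ k => q / e * q ^ k) i (k i)).det := by
  have hsym : ∀ (y : Fin r → ℂ) (i j : Fin r),
      (y i - y j) / (x i - x j) = (y j - y i) / (x j - x i) := fun y i j => by
    rw [← neg_sub (y j), ← neg_sub (x j), neg_div_neg_eq]
  set y : Fin r → ℂ := fun i => S.piecewise (fun i k => x i * q ^ k)
    (fun _ k => q / e * q ^ k) i (k i) with hy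
  rw [det_vandermonde_div hx y, prod_lt_eq_mul_of_symm _ (hsym y) S,
    pow_choose_sub_eq (div_ne_zero hq0 he), ← Finset.prod_mul_prod_compl S]
  have y1 : ∀ i ∈ S, y i = x i * q ^ k i := fun i hi => by simp [hy, hi]
  have y2 : ∀ i ∈ Sᶜ, y i = q / e * q ^ k i := fun i hi => by
    simp [hy, Finset.mem_compl.1 hi]
  have e1 : ∏ i ∈ S, ∏ j ∈ S with i < j, (y i - y j) / (x i - x j) =
      ∏ i ∈ S, ∏ j ∈ S with i < j, (x i * q ^ k i - x j * q ^ k j) / (x i - x j) :=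
    Finset.prod_congr rfl fun i hi => Finset.prod_congr rfl fun j hj => by
      rw [y1 i hi, y1 j (Finset.mem_filter.1 hj).1]
  have e2 : ∏ i ∈ Sᶜ, ∏ j ∈ Sᶜ with i < j, (y i - y j) / (x i - x j) =
      (∏ i ∈ Sᶜ, ∏ j ∈ Sᶜ with i < j, q / e) *
        ∏ i ∈ Sᶜ, ∏ j ∈ Sᶜ with i < j, (q ^ k i - q ^ k j) / (x i - x j) := by
    simp only [← Finset.prod_mul_distrib]
    exact Finset.prod_congr rfl fun i hi => Finset.prod_congr rfl fun j hj => by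
      rw [y2 i hi, y2 j (Finset.mem_filter.1 hj).1]
      ring
  have e3 : ∏ i ∈ S, ∏ j ∈ Sᶜ, (y i - y j) / (x i - x j) =
      (∏ i ∈ S, ∏ j ∈ Sᶜ, q / e) *
        ∏ i ∈ S, ∏ j ∈ Sᶜ, (e * x i * q ^ ((k i : ℤ) - 1) - q ^ k j) / (x i - x j) := by
    simp only [← Finset.prod_mul_distrib]
    exact Finset.prod_congr rfl fun i hi => Finset.prod_congr rfl fun j hj => by
      rw [y1 i hi, y2 j hj, zpow_sub_one₀ hq0, zpow_natCast, ← mul_div_assoc]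
      congr 1
      field_simp
  have e4 : ∏ i ∈ S, S.piecewise
          (fun i k => q ^ k * phiTerm q (a * x i) (b * x i) c (e * x i) (f * x i) k)
          (fun i k => q ^ k * phiTerm q (a * q / e) (b * q / e) (c * q / (e * x i))
            (q ^ 2 / (e * x i)) (f * q / e) k) i (k i) =
      (∏ i ∈ S, q ^ k i) *
        ∏ i ∈ S, phiTerm q (a * x i) (b * x i) c (e * x i) (f * x i) (k i) := by
    rw [← Finset.prod_mul_distrib]
    exact Finset.prod_congr rfl fun i hi => by simp [hi]
  have e5 : ∏ i ∈ Sᶜ, S.piecewise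
          (fun i k => q ^ k * phiTerm q (a * x i) (b * x i) c (e * x i) (f * x i) k)
          (fun i k => q ^ k * phiTerm q (a * q / e) (b * q / e) (c * q / (e * x i))
            (q ^ 2 / (e * x i)) (f * q / e) k) i (k i) =
      (∏ i ∈ Sᶜ, q ^ k i) *
        ∏ i ∈ Sᶜ, phiTerm q (a * q / e) (b * q / e) (c * q / (e * x i))
            (q ^ 2 / (e * x i)) (f * q / e) (k i) := by
    rw [← Finset.prod_mul_distrib]
    exact Finset.prod_congr rfl fun i hi => by simp [Finset.mem_compl.1 hi]
  have e6 : q ^ (∑ i, k i) = (∏ i ∈ S, q ^ k i) * ∏ i ∈ Sᶜ, q ^ k i := by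
    rw [Finset.prod_mul_prod_compl, Finset.prod_pow_eq_pow_sum]
  rw [e1, e2, e3, e4, e5, arSummand, e6]
  simp only [phiTerm]
  ring

end SummandAsDeterminant

/-! ### Moments of `₃φ₂` series and their evaluation on shifted factorials -/

section Moments

variable {q : ℂ}

theorem uniformlyBoundedAlong_phiTerm (hq : ‖q‖ < 1) {α : Type*} {l : Filter α} {A B C : α → ℂ}
    {A₀ B₀ C₀ E F : ℂ} (hA : Tendsto A l (𝓝 A₀)) (hB : Tendsto B l (𝓝 B₀))
    (hC : Tendsto C l (𝓝 C₀)) (hE : ∀ n : ℕ, E * q ^ n ≠ 1) (hF : ∀ n : ℕ, F * q ^ n ≠ 1) :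
    UniformlyBoundedAlong l fun t k => phiTerm q (A t) (B t) (C t) E F k := by
  have := (((uniformlyBoundedAlong_qPoch hq hA).mul (uniformlyBoundedAlong_qPoch hq hB)).mul
    (uniformlyBoundedAlong_qPoch hq hC)).mul
    (((uniformlyBoundedAlong_inv_qPoch hq (mul_pow_ne_one_of_norm_lt hq)).mul
    (uniformlyBoundedAlong_inv_qPoch hq hE)).mul (uniformlyBoundedAlong_inv_qPoch hq hF))
  simpa only [phiTerm, div_eq_mul_inv, mul_inv] using this

theorem uniformlyBoundedAlong_pow (hq : ‖q‖ < 1) {α : Type*} {l : Filter α} (z : ℂ) (j : ℕ) :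
    UniformlyBoundedAlong l fun _ k => (z * q ^ k) ^ j :=
  ⟨‖z‖ ^ j, Eventually.of_forall fun _ k => by
    rw [norm_pow, norm_mul, norm_pow]
    gcongr
    exact mul_le_of_le_one_right (norm_nonneg _) (pow_le_one₀ (norm_nonneg _) hq.le)⟩

/-- The `₃φ₂` series whose `k`-th term is multiplied by `p (z q ^ k)`. -/
noncomputable def phiMoment (q A B C E F z : ℂ) (p : ℂ → ℂ) : ℂ :=
  ∑' k, q ^ k * phiTerm q A B C E F k * p (z * q ^ k)

theorem summable_phiTerm_mul_pow (hq : ‖q‖ < 1) {E F : ℂ} (hE : ∀ n : ℕ, E * q ^ n ≠ 1)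
    (hF : ∀ n : ℕ, F * q ^ n ≠ 1) (A B C z : ℂ) (j : ℕ) :
    Summable fun k => q ^ k * phiTerm q A B C E F k * (z * q ^ k) ^ j := by
  simp only [mul_assoc (q ^ _)]
  exact UniformlyBoundedAlong.summable hq
    ((uniformlyBoundedAlong_phiTerm hq (tendsto_const_nhds (x := A)) (tendsto_const_nhds (x := B))
    (tendsto_const_nhds (x := C)) hE hF).mul (uniformlyBoundedAlong_pow hq z j))

theorem phiMoment_polynomial (hq : ‖q‖ < 1) {E F : ℂ} (hE : ∀ n : ℕ, E * q ^ n ≠ 1)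
    (hF : ∀ n : ℕ, F * q ^ n ≠ 1) (A B C z : ℂ) {r : ℕ} {p : Polynomial ℂ}
    (hp : p.natDegree < r) :
    phiMoment q A B C E F z (fun y => p.eval y) =
      ∑ j : Fin r, p.coeff j * phiMoment q A B C E F z (fun y => y ^ (j : ℕ)) := by
  simp only [phiMoment, ← tsum_mul_left]
  rw [← Summable.tsum_finsetSum fun (j : Fin r) _ =>
    (summable_phiTerm_mul_pow hq hE hF A B C z (j : ℕ)).mul_left (p.coeff j)]
  congr 1 with k
  rw [Polynomial.eval_eq_sum_range' hp, Finset.sum_range, Finset.mul_sum]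
  exact Finset.sum_congr rfl fun j _ => by ring

theorem tendsto_phiMoment_pow (hq : ‖q‖ < 1) {α : Type*} {l : Filter α} {A B C : α → ℂ}
    {A₀ B₀ C₀ E F : ℂ} (hA : Tendsto A l (𝓝 A₀)) (hB : Tendsto B l (𝓝 B₀))
    (hC : Tendsto C l (𝓝 C₀)) (hE : ∀ n : ℕ, E * q ^ n ≠ 1) (hF : ∀ n : ℕ, F * q ^ n ≠ 1)
    (z : ℂ) (j : ℕ) :
    Tendsto (fun t => phiMoment q (A t) (B t) (C t) E F z (fun y => y ^ j)) l
      (𝓝 (phiMoment q A₀ B₀ C₀ E F z fun y => y ^ j)) := by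
  simp only [phiMoment, mul_assoc (q ^ _)]
  refine ((uniformlyBoundedAlong_phiTerm hq hA hB hC hE hF).mul
    (uniformlyBoundedAlong_pow hq z j)).tendsto_tsum hq fun k => ?_
  have h (u : α → ℂ) (u₀ : ℂ) (hu : Tendsto u l (𝓝 u₀)) :
      Tendsto (fun t => qPoch (u t) q k) l (𝓝 (qPoch u₀ q k)) :=
    ((continuous_qPoch q k).tendsto u₀).comp hu
  exact ((((h A A₀ hA).mul (h B B₀ hB)).mul (h C C₀ hC)).div_const _).mul_const _

/-- Since `(u; q)_k (u q^k; q)_s = (u; q)_s (u q^s; q)_k`, the test function only shifts the first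
two upper parameters. The condition on `F` says that the shifted series is balanced. -/
theorem phiMoment_qPoch (hq : ‖q‖ < 1) {a b C w z F : ℂ} {s t : ℕ}
    (hF : ∀ n : ℕ, F * q ^ n ≠ 1) (hFeq : F = a * z * q ^ s * (b * z * q ^ t) * C * w) :
    phiMoment q (a * z) (b * z) C (q * w⁻¹) F z (fun y => qPoch (a * y) q s * qPoch (b * y) q t) =
      qPoch (a * z) q s * qPoch (b * z) q t *
        (balancedSeries q w (a * z * q ^ s) (b * z * q ^ t) C / qPochInf F q) := by
  rw [phiMoment, balancedSeries, ← tsum_div_const, ← tsum_mul_left]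
  congr 1 with k
  have h1 := qPoch_mul_qPoch_comm (a * z) q s k
  have h2 := qPoch_mul_qPoch_comm (b * z) q t k
  have h3 := qPoch_mul_qPochInf hq F k
  have h4 := qPoch_ne_zero hF k
  have h5 := qPochInf_ne_zero hq hF
  rw [balancedTerm, ← hFeq, phiTerm, ← mul_assoc a, ← mul_assoc b]
  have h6 : qPochInf (F * q ^ k) q / qPochInf F q = (qPoch F q k)⁻¹ := by
    rw [← h3] at h5 ⊢
    rw [div_eq_mul_inv, mul_inv, mul_left_comm, mul_inv_cancel₀ (right_ne_zero_of_mul h5), mul_one]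
  calc _ = q ^ k * (qPoch (a * z) q k * qPoch (a * z * q ^ k) q s) *
        (qPoch (b * z) q k * qPoch (b * z * q ^ k) q t) * qPoch C q k *
          ((qPoch q q k)⁻¹ * (qPoch (q * w⁻¹) q k)⁻¹ * (qPoch F q k)⁻¹) := by
        rw [div_eq_mul_inv, mul_inv, mul_inv]
        ring
    _ = _ := by
        rw [h1, h2, ← h6]
        ring

/-- The coefficient of the second series in the two-term combination attached to the variable `x`. -/
noncomputable def secondCoeff (q a b c e f x : ℂ) : ℂ :=
  (qPochInf (a * x) q * qPochInf (b * x) q * qPochInf c q * qPochInf (q / (e * x)) q *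
      qPochInf (f * q / e) q) /
    (qPochInf (a * q / e) q * qPochInf (b * q / e) q * qPochInf (c * q / (e * x)) q *
      qPochInf (e * x / q) q * qPochInf (f * x) q)

/-- The linear functional, given by a two-term combination of `₃φ₂` series, that acts on
functions of the `i`-th variable when `x = x i`. -/
noncomputable def pairMoment (q a b c e f x : ℂ) (p : ℂ → ℂ) : ℂ :=
  phiMoment q (a * x) (b * x) c (e * x) (f * x) x p +
    secondCoeff q a b c e f x *
      phiMoment q (a * q / e) (b * q / e) (c * q / (e * x)) (q ^ 2 / (e * x)) (f * q / e) (q / e) p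

theorem pairMoment_qPoch (hq0 : q ≠ 0) (hq : ‖q‖ < 1) {a b c e f x : ℂ} {s t : ℕ}
    (hbal : e * f = a * b * c * q ^ (s + t + 1))
    (ha : a ≠ 0) (hb : b ≠ 0) (hc : c ≠ 0) (he : e ≠ 0) (hx0 : x ≠ 0)
    (hae : ∀ n : ℕ, a * q / e * q ^ n ≠ 1) (hbe : ∀ n : ℕ, b * q / e * q ^ n ≠ 1)
    (hfe : ∀ n : ℕ, f * q / e * q ^ n ≠ 1) (hce : ∀ n : ℕ, c * q / (e * x) * q ^ n ≠ 1)
    (hfx : ∀ n : ℕ, f * x * q ^ n ≠ 1) (hex : ∀ m : ℤ, e * x ≠ q ^ m) :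
    pairMoment q a b c e f x (fun y => qPoch (a * y) q s * qPoch (b * y) q t) =
      qPochInf (q / (e * x)) q * qPochInf (f * x / c) q /
          (qPochInf (c * q / (e * x)) q * qPochInf (f * x) q) *
        (qPochInf (f * q ^ (-(s : ℤ)) / a) q * qPochInf (f * q ^ (-(t : ℤ)) / b) q /
          (qPochInf (a * q ^ (s + 1) / e) q * qPochInf (b * q ^ (t + 1) / e) q)) *
        (qPoch (a * x) q s * qPoch (b * x) q t) := by
  -- This choice makes the lower parameter `e * x` equal to `q / w`; the second series then belongs
  -- to `w⁻¹`, as in `balancedPair`.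
  obtain ⟨w, hw⟩ : ∃ w, w = q / (e * x) := ⟨_, rfl⟩
  have hw0 : w ≠ 0 := hw ▸ div_ne_zero hq0 (mul_ne_zero he hx0)
  have hwz : ∀ m : ℤ, w ≠ q ^ m := fun m h => hex (1 - m) (by
    rw [zpow_sub₀ hq0, ← h, hw, zpow_one]
    field_simp)
  have hf : f = a * b * c * q ^ (s + t + 1) / e := by field_simp; linear_combination hbal
  have hex1 : e * x = q * w⁻¹ := by rw [hw]; field_simp
  have hex2 : e * x / q = w⁻¹ := by rw [hw]; field_simp
  have hex3 : q ^ 2 / (e * x) = q * w⁻¹⁻¹ := by rw [hw]; field_simp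
  have haw : a * q / e = a * (q / e) := by ring
  have hbw : b * q / e = b * (q / e) := by ring
  have hcw : c * q / (e * x) = c * w := by rw [hw]; ring
  have h1 := phiMoment_qPoch (a := a) (b := b) (C := c) (w := w) (z := x) (s := s) (t := t) hq hfx
    (by rw [hf, hw]; field_simp; ring)
  have h2 := phiMoment_qPoch (a := a) (b := b) (C := c * w) (w := w⁻¹) (z := q / e) (s := s)
    (t := t) hq hfe (by rw [hf, hw]; field_simp; ring)
  have h3 := balancedPair_eq hq0 hq hw0 hwz (a * x * q ^ s) (b * x * q ^ t) c
  have eA : a * (q / e) * q ^ s = a * x * q ^ s * w := by rw [hw]; field_simp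
  have eB : b * (q / e) * q ^ t = b * x * q ^ t * w := by rw [hw]; field_simp
  have eA' : a * q ^ (s + 1) / e = a * x * q ^ s * w := by rw [hw]; field_simp; ring
  have eB' : b * q ^ (t + 1) / e = b * x * q ^ t * w := by rw [hw]; field_simp; ring
  have eF1 : f * x / c = a * x * q ^ s * (b * x * q ^ t) * w := by
    rw [hf, hw]; field_simp; ring
  have eF2 : f * q ^ (-(s : ℤ)) / a = b * x * q ^ t * c * w := by
    rw [hf, hw, zpow_neg, zpow_natCast]; field_simp; ring
  have eF3 : f * q ^ (-(t : ℤ)) / b = a * x * q ^ s * c * w := by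
    rw [hf, hw, zpow_neg, zpow_natCast]; field_simp; ring
  have hwi : ∀ m : ℤ, w⁻¹ ≠ q ^ m := inv_ne_zpow hwz
  have n1 := qPochInf_ne_zero hq (mul_pow_ne_one_of_ne_zpow hwz)
  have n2 := qPochInf_ne_zero hq (mul_pow_ne_one_of_ne_zpow hwi)
  have n3 := qPochInf_ne_zero hq hfx
  have n4 := qPochInf_ne_zero hq hfe
  have n5 := qPochInf_ne_zero hq hce
  have n6 := qPochInf_ne_zero hq hae
  have n7 := qPochInf_ne_zero hq hbe
  have p1 := qPoch_mul_qPochInf hq (a * x) s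
  have p2 := qPoch_mul_qPochInf hq (b * x) t
  have p3 := qPoch_mul_qPochInf hq (a * (q / e)) s
  have p4 := qPoch_mul_qPochInf hq (b * (q / e)) t
  rw [pairMoment, secondCoeff, eA', eB', eF1, eF2, eF3, hex3, hex2, hcw, ← hw, hex1, haw, hbw, h1,
    h2, eA, eB]
  rw [hcw] at n5
  rw [haw, ← p3, eA] at n6
  rw [hbw, ← p4, eB] at n7
  rw [← p1, ← p2, ← p3, ← p4, eA, eB]
  rw [balancedPair] at h3
  generalize balancedSeries q w (a * x * q ^ s) (b * x * q ^ t) c = s1 at *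
  generalize balancedSeries q w⁻¹ (a * x * q ^ s * w) (b * x * q ^ t * w) (c * w) = s2 at *
  have n8 := right_ne_zero_of_mul n6
  have n9 := right_ne_zero_of_mul n7
  have n10 := left_ne_zero_of_mul n6
  have n11 := left_ne_zero_of_mul n7
  generalize qPoch (a * x) q s = v1 at *
  generalize qPoch (b * x) q t = v2 at *
  generalize qPoch (a * (q / e)) q s = v3 at *
  generalize qPoch (b * (q / e)) q t = v4 at *
  generalize qPochInf (a * x * q ^ s * w) q = u1 at *
  generalize qPochInf (b * x * q ^ t * w) q = u2 at *
  generalize qPochInf (c * w) q = u3 at *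
  generalize qPochInf (f * x) q = u4 at *
  generalize qPochInf (f * q / e) q = u5 at *
  generalize qPochInf (a * x * q ^ s) q = u6 at *
  generalize qPochInf (b * x * q ^ t) q = u7 at *
  generalize qPochInf (a * x * q ^ s * (b * x * q ^ t) * w) q = u8 at *
  generalize qPochInf (a * x * q ^ s * c * w) q = u9 at *
  generalize qPochInf (b * x * q ^ t * c * w) q = u10 at *
  generalize qPochInf c q = u11 at *
  generalize qPochInf w q = u12 at *
  generalize qPochInf w⁻¹ q = u13 at *
  -- After the common factor is extracted, the bracket is `balancedPair` at `A = a x q^s`, `B = b x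
  -- q^t`, `C = c`.
  calc _ = v1 * v2 * u12 / (u1 * u2 * u3 * u4) *
        (u1 * u2 * u3 * s1 / u12 + u6 * u7 * u11 * s2 / u13) := by
        field_simp
    _ = _ := by
        rw [h3]
        field_simp

end Moments

/-! ### Evaluation of the moment determinant -/

section MomentDeterminant

variable {r : ℕ} {q a b c e f : ℂ} {x : Fin r → ℂ}

/-- The polynomial `(a X; q)_s`. -/
noncomputable def qPochPolynomial (a q : ℂ) (s : ℕ) : Polynomial ℂ :=
  ∏ j ∈ Finset.range s, (1 - Polynomial.C (a * q ^ j) * Polynomial.X)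

theorem eval_qPochPolynomial (a q y : ℂ) (s : ℕ) :
    (qPochPolynomial a q s).eval y = qPoch (a * y) q s := by
  simp only [qPochPolynomial, qPoch, Polynomial.eval_prod, Polynomial.eval_sub,
    Polynomial.eval_one, Polynomial.eval_mul, Polynomial.eval_C, Polynomial.eval_X]
  exact Finset.prod_congr rfl fun j _ => by ring

theorem natDegree_qPochPolynomial_le (a q : ℂ) (s : ℕ) :
    (qPochPolynomial a q s).natDegree ≤ s := by
  have h (u : ℂ) : (1 - Polynomial.C u * Polynomial.X).natDegree ≤ 1 := by compute_degree
  refine (Polynomial.natDegree_prod_le _ _).trans ?_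
  refine (Finset.sum_le_sum fun j _ => h (a * q ^ j)).trans ?_
  simp

/-- The polynomials `(a X; q)_s (b X; q)_{r - 1 - s}` for `s < r`. -/
noncomputable def pochBasis (r : ℕ) (a b q : ℂ) (s : Fin r) : Polynomial ℂ :=
  qPochPolynomial a q s * qPochPolynomial b q s.rev

theorem eval_pochBasis (s : Fin r) (y : ℂ) :
    (pochBasis r a b q s).eval y = qPoch (a * y) q s * qPoch (b * y) q s.rev := by
  simp only [pochBasis, Polynomial.eval_mul, eval_qPochPolynomial]

theorem natDegree_pochBasis_lt (s : Fin r) : (pochBasis r a b q s).natDegree < r := by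
  have h1 := natDegree_qPochPolynomial_le a q s
  have h2 := natDegree_qPochPolynomial_le b q s.rev
  have h3 : (pochBasis r a b q s).natDegree ≤ _ := Polynomial.natDegree_mul_le
  have := s.is_lt
  have := Fin.val_rev s
  omega

/-- The coefficients of the polynomials `pochBasis`. -/
noncomputable def pochBasisMatrix (r : ℕ) (a b q : ℂ) : Matrix (Fin r) (Fin r) ℂ :=
  Matrix.of fun j s => (pochBasis r a b q s).coeff j

theorem vandermonde_mul_pochBasisMatrix (y : Fin r → ℂ) :
    Matrix.vandermonde y * pochBasisMatrix r a b q =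
      Matrix.of fun i (s : Fin r) => qPoch (a * y i) q s * qPoch (b * y i) q (s.rev : ℕ) := by
  ext i s
  rw [Matrix.of_apply, ← eval_pochBasis,
    Polynomial.eval_eq_sum_range' (natDegree_pochBasis_lt s), Finset.sum_range, Matrix.mul_apply]
  exact Finset.sum_congr rfl fun j _ => mul_comm _ _

theorem zpow_ne_one_of_norm_lt (hq : ‖q‖ < 1) {m : ℤ} (hm : m ≠ 0) : q ^ m ≠ 1 := by
  intro h
  have h1 : ‖q‖ ^ m = 1 := by rw [← norm_zpow, h, norm_one]
  exact hm ((zpow_eq_one_iff_right₀ (norm_nonneg q) hq.ne).1 h1)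

/-- At the nodes `(a q^i)⁻¹` the factor `(q^{-i}; q)_s` vanishes for `s > i`, so the matrix of
values is triangular. Its diagonal is nonzero because `q` is not a root of unity and `a ∉ b q^ℤ`;
the base change is a factor of this matrix. -/
theorem det_pochBasisMatrix_ne_zero (hq0 : q ≠ 0) (hq : ‖q‖ < 1) (ha : a ≠ 0)
    (hab : ∀ m : ℤ, a ≠ b * q ^ m) : (pochBasisMatrix r a b q).det ≠ 0 := by
  have h := congrArg Matrix.det (vandermonde_mul_pochBasisMatrix (a := a) (b := b) (q := q)
    fun i : Fin r => (a * q ^ (i : ℕ))⁻¹)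
  rw [Matrix.det_mul] at h
  refine right_ne_zero_of_mul (ne_of_eq_of_ne h ?_)
  rw [Matrix.det_of_isLowerTriangular]
  · refine Finset.prod_ne_zero_iff.2 fun i _ => ?_
    rw [Matrix.of_apply]
    refine mul_ne_zero ?_ ?_ <;> refine Finset.prod_ne_zero_iff.2 fun j hj h0 => ?_
    · refine zpow_ne_one_of_norm_lt hq (m := (j : ℤ) - (i : ℕ)) ?_ ?_
      · have := Finset.mem_range.1 hj
        omega
      · rw [zpow_sub₀ hq0, zpow_natCast, zpow_natCast, eq_comm, ← sub_eq_zero, ← h0]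
        field_simp
    · refine hab ((j : ℤ) - (i : ℕ)) ?_
      rw [zpow_sub₀ hq0, zpow_natCast, zpow_natCast, ← sub_eq_zero]
      have : a - b * (q ^ j / q ^ (i : ℕ)) =
          a * (1 - b * (a * q ^ (i : ℕ))⁻¹ * q ^ j) := by field_simp
      rw [this, h0, mul_zero]
  · intro i s his
    have his' : (i : ℕ) < s := his
    rw [Matrix.of_apply]
    refine mul_eq_zero_of_left (Finset.prod_eq_zero (Finset.mem_range.2 his') ?_) _
    field_simp
    simp

theorem pairMoment_polynomial (hq : ‖q‖ < 1) {y : ℂ} (he : ∀ n : ℕ, e * y * q ^ n ≠ 1)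
    (hf : ∀ n : ℕ, f * y * q ^ n ≠ 1) (he' : ∀ n : ℕ, q ^ 2 / (e * y) * q ^ n ≠ 1)
    (hf' : ∀ n : ℕ, f * q / e * q ^ n ≠ 1) {p : Polynomial ℂ} (hp : p.natDegree < r) :
    pairMoment q a b c e f y (fun z => p.eval z) =
      ∑ j : Fin r, pairMoment q a b c e f y (fun z => z ^ (j : ℕ)) * p.coeff j := by
  simp only [pairMoment, phiMoment_polynomial hq he hf _ _ _ _ hp,
    phiMoment_polynomial hq he' hf' _ _ _ _ hp, Finset.mul_sum, ← Finset.sum_add_distrib]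
  exact Finset.sum_congr rfl fun j _ => by ring

theorem sq_div_mul_pow_ne_one (hq0 : q ≠ 0) {u : ℂ} (hu0 : u ≠ 0) (hu : ∀ m : ℤ, u ≠ q ^ m)
    (n : ℕ) : q ^ 2 / u * q ^ n ≠ 1 := fun h => hu (n + 2) (by
  rw [zpow_add₀ hq0, zpow_natCast]
  field_simp at h
  rw [← h]
  norm_cast
  ring)

theorem det_pairMoment_of_ne (hq0 : q ≠ 0) (hq : ‖q‖ < 1) (hbal : e * f = a * b * c * q ^ r)
    (ha : a ≠ 0) (hb : b ≠ 0) (hc : c ≠ 0) (he : e ≠ 0) (hx0 : ∀ i, x i ≠ 0)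
    (hae : ∀ n : ℕ, a * q / e * q ^ n ≠ 1) (hbe : ∀ n : ℕ, b * q / e * q ^ n ≠ 1)
    (hfe : ∀ n : ℕ, f * q / e * q ^ n ≠ 1) (hce : ∀ i, ∀ n : ℕ, c * q / (e * x i) * q ^ n ≠ 1)
    (hfx : ∀ i, ∀ n : ℕ, f * x i * q ^ n ≠ 1) (hex : ∀ i, ∀ m : ℤ, e * x i ≠ q ^ m)
    (hab : ∀ m : ℤ, a ≠ b * q ^ m) :
    (Matrix.of fun i j : Fin r => pairMoment q a b c e f (x i) fun z => z ^ (j : ℕ)).det =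
      arProduct q a b c e f x * (Matrix.vandermonde x).det := by
  have hrow (i s : Fin r) : ∑ j : Fin r, pairMoment q a b c e f (x i) (fun z => z ^ (j : ℕ)) *
        (pochBasis r a b q s).coeff j = _ :=
    (pairMoment_polynomial hq (mul_pow_ne_one_of_ne_zpow (hex i)) (hfx i)
      (sq_div_mul_pow_ne_one hq0 (mul_ne_zero he (hx0 i)) (hex i)) hfe
      (natDegree_pochBasis_lt s)).symm
  -- In the new basis the moment matrix is the matrix of values `p_s(x_i)` with its rows and columns
  -- rescaled, so the base change cancels from both sides after taking determinants.
  have hmul : (Matrix.of fun i j : Fin r => pairMoment q a b c e f (x i) fun z => z ^ (j : ℕ)) *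
      pochBasisMatrix r a b q = Matrix.of fun i s : Fin r =>
        qPochInf (q / (e * x i)) q * qPochInf (f * x i / c) q /
          (qPochInf (c * q / (e * x i)) q * qPochInf (f * x i) q) *
        (Matrix.of fun i s : Fin r =>
          qPochInf (f * q ^ (-((s : ℕ) : ℤ)) / a) q * qPochInf (f * q ^ (-((s.rev : ℕ) : ℤ)) / b) q /
          (qPochInf (a * q ^ ((s : ℕ) + 1) / e) q * qPochInf (b * q ^ ((s.rev : ℕ) + 1) / e) q) *
          (Matrix.vandermonde x * pochBasisMatrix r a b q) i s) i s := by
    ext i s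
    have hs : (s : ℕ) + (s.rev : ℕ) + 1 = r := by
      have := s.is_lt
      have := Fin.val_rev s
      omega
    rw [Matrix.mul_apply]
    refine (hrow i s).trans ?_
    simp only [eval_pochBasis, Matrix.of_apply, vandermonde_mul_pochBasisMatrix]
    rw [pairMoment_qPoch hq0 hq (by rw [hs, hbal]) ha hb hc he (hx0 i) hae hbe hfe (hce i)
      (hfx i) (hex i)]
    ring
  have hdet := congrArg Matrix.det hmul
  rw [Matrix.det_mul, Matrix.det_mul_column, Matrix.det_mul_row, Matrix.det_mul] at hdet
  refine mul_right_cancel₀ (det_pochBasisMatrix_ne_zero hq0 hq ha hab) (hdet.trans ?_)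
  -- The column factors involving `b` carry the index `r - 1 - s`; reversal matches them with the
  -- product side.
  have hrev (g : ℕ → ℂ) : ∏ s : Fin r, g (s.rev : ℕ) = ∏ s : Fin r, g s :=
    Equiv.prod_comp Fin.revPerm fun s : Fin r => g s
  simp only [arProduct, Finset.prod_div_distrib, Finset.prod_mul_distrib]
  rw [hrev fun s => qPochInf (f * q ^ (-(s : ℤ)) / b) q,
    hrev fun s => qPochInf (b * q ^ (s + 1) / e) q]
  ring

theorem Filter.Tendsto.qPochInf (hq : ‖q‖ < 1) {α : Type*} {l : Filter α} {u : α → ℂ} {u₀ : ℂ}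
    (hu : Tendsto u l (𝓝 u₀)) : Tendsto (fun t => qPochInf (u t) q) l (𝓝 (qPochInf u₀ q)) :=
  ((continuous_qPochInf hq).tendsto u₀).comp hu

theorem tendsto_det_pairMoment (hq0 : q ≠ 0) (hq : ‖q‖ < 1) (he : e ≠ 0) (hx0 : ∀ i, x i ≠ 0)
    (hae : ∀ n : ℕ, a * q / e * q ^ n ≠ 1) (hbe : ∀ n : ℕ, b * q / e * q ^ n ≠ 1)
    (hfe : ∀ n : ℕ, f * q / e * q ^ n ≠ 1) (hce : ∀ i, ∀ n : ℕ, c * q / (e * x i) * q ^ n ≠ 1)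
    (hfx : ∀ i, ∀ n : ℕ, f * x i * q ^ n ≠ 1) (hex : ∀ i, ∀ m : ℤ, e * x i ≠ q ^ m)
    {α : Type*} {l : Filter α} {A C : α → ℂ} (hA : Tendsto A l (𝓝 a)) (hC : Tendsto C l (𝓝 c)) :
    Tendsto (fun t => (Matrix.of fun i j : Fin r =>
        pairMoment q (A t) b (C t) e f (x i) fun z => z ^ (j : ℕ)).det) l
      (𝓝 (Matrix.of fun i j : Fin r =>
        pairMoment q a b c e f (x i) fun z => z ^ (j : ℕ)).det) := by
  refine ((continuous_id.matrix_det).tendsto _).comp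
    (tendsto_pi_nhds.2 fun i => tendsto_pi_nhds.2 fun j => ?_)
  have hEX := mul_pow_ne_one_of_ne_zpow (hex i)
  have hEX' := sq_div_mul_pow_ne_one hq0 (mul_ne_zero he (hx0 i)) (hex i)
  have hinv : ∀ n : ℕ, e * x i / q * q ^ n ≠ 1 := mul_pow_ne_one_of_ne_zpow fun m h =>
    hex i (m + 1) (by rw [zpow_add_one₀ hq0, ← h]; field_simp)
  refine (tendsto_phiMoment_pow hq (hA.mul_const _) tendsto_const_nhds hC hEX (hfx i) _ _).add
    (Tendsto.mul ?_ (tendsto_phiMoment_pow hq ((hA.mul_const _).div_const _) tendsto_const_nhds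
      ((hC.mul_const _).div_const _) hEX' hfe _ _))
  refine Tendsto.div (((((hA.mul_const _).qPochInf hq).mul_const _).mul (hC.qPochInf hq)
    |>.mul_const _).mul_const _) ((((((hA.mul_const _).div_const _).qPochInf hq).mul_const _).mul
    (((hC.mul_const _).div_const _).qPochInf hq) |>.mul_const _).mul_const _) ?_
  have n1 := qPochInf_ne_zero hq hae
  have n2 := qPochInf_ne_zero hq hbe
  have n3 := qPochInf_ne_zero hq (hce i)
  have n4 := qPochInf_ne_zero hq hinv
  have n5 := qPochInf_ne_zero hq (hfx i)
  positivity

theorem mul_pow_succ_div_mul_pow_ne_one (hae : ∀ n : ℕ, a * q / e * q ^ n ≠ 1) (s n : ℕ) :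
    a * q ^ (s + 1) / e * q ^ n ≠ 1 := by
  convert hae (s + n) using 1
  ring

theorem tendsto_arProduct (hq : ‖q‖ < 1) (ha : a ≠ 0) (hc : c ≠ 0)
    (hae : ∀ n : ℕ, a * q / e * q ^ n ≠ 1) (hbe : ∀ n : ℕ, b * q / e * q ^ n ≠ 1)
    (hce : ∀ i, ∀ n : ℕ, c * q / (e * x i) * q ^ n ≠ 1)
    (hfx : ∀ i, ∀ n : ℕ, f * x i * q ^ n ≠ 1)
    {α : Type*} {l : Filter α} {A C : α → ℂ} (hA : Tendsto A l (𝓝 a)) (hC : Tendsto C l (𝓝 c)) :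
    Tendsto (fun t => arProduct q (A t) b (C t) e f x) l (𝓝 (arProduct q a b c e f x)) := by
  refine tendsto_finsetProd _ fun i _ => ?_
  refine Tendsto.div ((((tendsto_const_nhds.div hA ha).qPochInf hq).const_mul _).mul_const _ |>.mul
    ((tendsto_const_nhds.div hC hc).qPochInf hq)) (((((hA.mul_const _).div_const _).qPochInf
    hq).mul_const _).mul (((hC.mul_const _).div_const _).qPochInf hq) |>.mul_const _) ?_
  have n1 := qPochInf_ne_zero hq (mul_pow_succ_div_mul_pow_ne_one hae i)
  have n2 := qPochInf_ne_zero hq (mul_pow_succ_div_mul_pow_ne_one hbe i)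
  have n3 := qPochInf_ne_zero hq (hce i)
  have n5 := qPochInf_ne_zero hq (hfx i)
  positivity

theorem det_pairMoment (hq0 : q ≠ 0) (hq : ‖q‖ < 1) (hbal : e * f = a * b * c * q ^ r)
    (ha : a ≠ 0) (hb : b ≠ 0) (hc : c ≠ 0) (he : e ≠ 0) (hx0 : ∀ i, x i ≠ 0)
    (hae : ∀ n : ℕ, a * q / e * q ^ n ≠ 1) (hbe : ∀ n : ℕ, b * q / e * q ^ n ≠ 1)
    (hfe : ∀ n : ℕ, f * q / e * q ^ n ≠ 1) (hce : ∀ i, ∀ n : ℕ, c * q / (e * x i) * q ^ n ≠ 1)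
    (hfx : ∀ i, ∀ n : ℕ, f * x i * q ^ n ≠ 1) (hex : ∀ i, ∀ m : ℤ, e * x i ≠ q ^ m) :
    (Matrix.of fun i j : Fin r => pairMoment q a b c e f (x i) fun z => z ^ (j : ℕ)).det =
      arProduct q a b c e f x * (Matrix.vandermonde x).det := by
  -- The deformation `a ↦ a t`, `c ↦ c / t` preserves `a * c`, hence the balancing condition with
  -- `e` and `f` fixed. The excluded `t`, those with `a t ∈ b q^ℤ`, are countable, so `1` is a limit
  -- of admissible values.
  let bad : Set ℂ := Set.range fun m : ℤ => b * q ^ m / a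
  have hcl : (1 : ℂ) ∈ closure badᶜ := (Set.countable_range _).dense_compl ℝ 1
  have : (𝓝[badᶜ] (1 : ℂ)).NeBot := mem_closure_iff_nhdsWithin_neBot.1 hcl
  have hid : Tendsto (fun t : ℂ => t) (𝓝[badᶜ] 1) (𝓝 1) := tendsto_nhdsWithin_of_tendsto_nhds tendsto_id
  have hA : Tendsto (fun t : ℂ => a * t) (𝓝[badᶜ] 1) (𝓝 a) := by
    simpa using hid.const_mul a
  have hC : Tendsto (fun t : ℂ => c / t) (𝓝[badᶜ] 1) (𝓝 c) := by
    have := (tendsto_const_nhds (x := c)).div hid one_ne_zero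
    rwa [div_one] at this
  refine tendsto_nhds_unique
    (tendsto_det_pairMoment hq0 hq he hx0 hae hbe hfe hce hfx hex hA hC) ?_
  refine Tendsto.congr' ?_
    ((tendsto_arProduct hq ha hc hae hbe hce hfx hA hC).mul_const (Matrix.vandermonde x).det)
  -- Infinitely many conditions `u q^n ≠ 1` are encoded as `(u; q)_∞ ≠ 0`, a single open condition
  -- that persists for `t` near `1`.
  have hAe := (((hA.mul_const q).div_const e).qPochInf hq).eventually_ne (qPochInf_ne_zero hq hae)
  have hCe : ∀ᶠ t in 𝓝[badᶜ] (1 : ℂ), ∀ i, qPochInf (c / t * q / (e * x i)) q ≠ 0 :=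
    eventually_all.2 fun i =>
      (((hC.mul_const q).div_const _).qPochInf hq).eventually_ne (qPochInf_ne_zero hq (hce i))
  filter_upwards [hAe, hCe, hid.eventually_ne one_ne_zero, self_mem_nhdsWithin] with t h1 h2 h3 h4
  refine (det_pairMoment_of_ne hq0 hq ?_ (mul_ne_zero ha h3) hb (div_ne_zero hc h3) he hx0
    (mul_pow_ne_one_of_qPochInf_ne_zero hq h1) hbe hfe
    (fun i => mul_pow_ne_one_of_qPochInf_ne_zero hq (h2 i)) hfx hex fun m hm => h4 ⟨m, ?_⟩).symm
  · rw [hbal]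
    field_simp
  · change b * q ^ m / a = t
    rw [← hm]
    field_simp

end MomentDeterminant

/-! ### Convergence of the multiple series and the final identity -/

section MainIdentity

variable {r : ℕ} {q a b c e f : ℂ} {x : Fin r → ℂ}

theorem hasSum_arSummand (hq0 : q ≠ 0) (hq : ‖q‖ < 1) (he : e ≠ 0) (hx0 : ∀ i, x i ≠ 0)
    (hx : Function.Injective x) (hfe : ∀ n : ℕ, f * q / e * q ^ n ≠ 1)
    (hfx : ∀ i, ∀ n : ℕ, f * x i * q ^ n ≠ 1) (hex : ∀ i, ∀ m : ℤ, e * x i ≠ q ^ m)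
    (S : Finset (Fin r)) :
    HasSum (fun k => (q / e) ^ (r.choose 2 - S.card.choose 2) *
        arSummand q a b c e f x S k * (Matrix.vandermonde x).det)
      (Matrix.of (S.piecewise
        (fun i (j : Fin r) => phiMoment q (a * x i) (b * x i) c (e * x i) (f * x i) (x i)
          fun y => y ^ (j : ℕ))
        (fun i (j : Fin r) => phiMoment q (a * q / e) (b * q / e) (c * q / (e * x i))
          (q ^ 2 / (e * x i)) (f * q / e) (q / e) fun y => y ^ (j : ℕ)))).det := by
  simp only [arSummand_mul_det_vandermonde hq0 he hx]
  convert hasSum_prod_mul_det_vandermonde _ _ ?_ using 3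
  · ext i j
    by_cases hi : i ∈ S <;> simp [Finset.piecewise, hi, phiMoment]
  · intro i j
    by_cases hi : i ∈ S
    · simpa only [Finset.piecewise, if_pos hi] using summable_phiTerm_mul_pow hq
        (mul_pow_ne_one_of_ne_zpow (hex i)) (hfx i) _ _ _ (x i) (j : ℕ)
    · simpa only [Finset.piecewise, if_neg hi] using summable_phiTerm_mul_pow hq
        (sq_div_mul_pow_ne_one hq0 (mul_ne_zero he (hx0 i)) (hex i)) hfe _ _ _ (q / e) (j : ℕ)

end MainIdentity

/-- A nonterminating `A_r` extension of the `₃φ₂` (`q`-Pfaff–Saalschütz) summation. The hypotheses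
after `hbal` say exactly that no denominator in the identity vanishes. -/
theorem corollary6p2 (r : ℕ) (q a b c e f : ℂ) (x : Fin r → ℂ)
    (hq0 : q ≠ 0) (hq1 : ‖q‖ < 1)
    (hbal : e * f = a * b * c * q ^ r)
    (ha : a ≠ 0) (hb : b ≠ 0) (hc : c ≠ 0) (he : e ≠ 0)
    (hx0 : ∀ i, x i ≠ 0) (hx : Function.Injective x)
    (hae : ∀ n : ℕ, a * q / e * q ^ n ≠ 1)
    (hbe : ∀ n : ℕ, b * q / e * q ^ n ≠ 1)
    (hfe : ∀ n : ℕ, f * q / e * q ^ n ≠ 1)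
    (hce : ∀ i, ∀ n : ℕ, c * q / (e * x i) * q ^ n ≠ 1)
    (hfx : ∀ i, ∀ n : ℕ, f * x i * q ^ n ≠ 1)
    (hex : ∀ i, ∀ m : ℤ, e * x i ≠ q ^ m) :
    (∀ S : Finset (Fin r), Summable (fun k : Fin r → ℕ => arSummand q a b c e f x S k)) ∧
      ∑ S : Finset (Fin r),
          arPrefactor q a b c e f x S * ∑' k : Fin r → ℕ, arSummand q a b c e f x S k =
        arProduct q a b c e f x := by
  have hV : (Matrix.vandermonde x).det ≠ 0 := Matrix.det_vandermonde_ne_zero_iff.2 hx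
  have hpow (S : Finset (Fin r)) : (q / e) ^ (r.choose 2 - S.card.choose 2) ≠ 0 :=
    pow_ne_zero _ (div_ne_zero hq0 he)
  have hS := hasSum_arSummand (a := a) (b := b) (c := c) hq0 hq1 he hx0 hx hfe hfx hex
  refine ⟨fun S => (summable_mul_left_iff (hpow S)).1
    ((summable_mul_right_iff hV).1 (hS S).summable), mul_right_cancel₀ hV ?_⟩
  -- Both sides now carry the nonzero factor `det (vandermonde x)`, and the product side becomes the
  -- moment determinant, which is expanded over `S` by rows.
  rw [← det_pairMoment hq0 hq1 hbal ha hb hc he hx0 hae hbe hfe hce hfx hex, Finset.sum_mul]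
  refine Eq.trans (Finset.sum_congr rfl fun S _ => ?_)
    (sum_det_piecewise _ _ fun i => secondCoeff q a b c e f (x i))
  rw [← (hS S).tsum_eq, tsum_mul_right, tsum_mul_left, arPrefactor]
  simp only [secondCoeff]
  ring
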